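/- A promise problem is a pair $L=(L_{\mathrm{yes}},L_{\mathrm{no}})$ of disjoint subsets of $\{0,1\}^*$. A polynomial-time uniform family of quantum circuits is a family $(V_x)_{x\in\{0,1\}^*}$ for which one deterministic polynomial-time Turing machine, on input $x$, outputs a description of the circuit $V_x$; here a circuit is a sequence of gates from a fixed universal set (Hadamard, $T$, CNOT) on finitely many qubits, with a designated output qubit. The circuit is run on given input registers together with workspace qubits in state $|0\rangle$, and it accepts if measuring the output qubit in the standard basis gives $1$. Write $\mathbf D(\mathcal H)$ for the set of density operators on $\mathcal H$. For a class $\mathcal C(c,s)$ depending on functions $c,s:\mathbb N\to[0,1]$, let $\mathcal C$ denote the union of the $\mathcal C(c,s)$ over all polynomial-time computable $c,s$ with $c-s\in\Omega(1/\mathrm{poly}(n))$. **One-turn quantum refereed games.** $L\in\mathsf{QRG}(1)(c,s)$ if there are a polynomial-time uniform family $V$ and polynomials $p,q$ such that $V_x$, for $|x|=n$, takes a $p(n)$-qubit state $\rho$ (from Alice) and a $q(n)$-qubit state $\sigma$ (from Bob), and - if $x\in L_{\mathrm{yes}}$, there is a state $\rho$ such that for all states $\sigma$, $\Pr[V_x(\rho\otimes\sigma)\text{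 accepts}]\ge c(n)$; - if $x\in L_{\mathrm{no}}$, there is a state $\sigma$ such that for all states $\rho$, $\Pr[V_x(\rho\otimes\sigma)\text{ accepts}]\le s(n)$. **The entangled quantum polynomial hierarchy.** Let $i\ge 0$ be a constant. $L\in\mathsf{Q\Sigma}^e_i(c,s)$ if there are a polynomial-time uniform family $V$ and polynomials $p_1,\dots,p_i$ such that, for $|x|=n$ and with $\mathcal X_j$ the space of $p_j(n)$ qubits, - if $x\in L_{\mathrm{yes}}$, then $\exists\rho_1\,\forall\rho_2\,\exists\rho_3\cdots Q_i\rho_i:\ \Pr[V_x\text{ accepts}]\ge c(n)$; - if $x\in L_{\mathrm{no}}$, then $\forall\rho_1\,\exists\rho_2\,\forall\rho_3\cdots \overline{Q_i}\rho_i:\ \Pr[V_x\text{ accepts}]\le s(n)$. Here $Q_i$ is $\exists$ for odd $i$ and $\forall$ for even $i$, and $\overline{Q_i}$ is the other quantifier. Each $\rho_j$ ranges over the density operators on $\mathcal X_1\otimes\mathcal X_3\otimes\cdots\otimes\mathcal X_j$ if $j$ is odd, and on $\mathcal X_2\otimes\mathcal X_4\otimes\cdots\otimes\mathcal X_j$ if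 $j$ is even, subject for $j>2$ to $\operatorname{tr}_{\mathcal X_j}(\rho_j)=\rho_{j-2}$. The circuit $V_x$ is run on $\rho\otimes\sigma$, where $\rho$ and $\sigma$ are the last state of odd index and the last state of even index (the trivial state if there is none). Finally, $\mathsf{QEPH}=\bigcup_{i=0}^{\infty}\mathsf{Q\Sigma}^e_i$. **Theorem.** $\mathsf{QRG}(1)=\mathsf{QEPH}=\mathsf{Q\Sigma}^e_2$. -/

import Mathlib

open scoped ComplexOrder Matrix

noncomputable section

namespace QGames

/-! ### Quantum registers -/

/-- Computational basis labels of a register of `n` qubits. -/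
abbrev Bits (n : ℕ) : Type := Fin n → Bool

/-- Linear operators on the Hilbert space of `n` qubits, as matrices in the computational basis. -/
abbrev Op (n : ℕ) : Type := Matrix (Bits n) (Bits n) ℂ

/-- `n`-qubit density matrices: positive semidefinite (hence Hermitian) of trace one. -/
def IsDensity {n : ℕ} (ρ : Op n) : Prop := ρ.PosSemidef ∧ ρ.trace = 1

/-- The partial trace over the last `m` qubits of a register of `a + m` qubits. -/
def ptrace {a m : ℕ} (ρ : Op (a + m)) : Op a :=
  fun u v => ∑ w : Bits m, ρ (Fin.append u w) (Fin.append v w)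

/-! ### Quantum circuits -/

/-- Elementary gates on `N` wires: the universal set Hadamard, `T = diag(1, exp(iπ/4))`, CNOT. -/
inductive Gate (N : ℕ) : Type
  | hadamard (q : Fin N) : Gate N
  | phaseT (q : Fin N) : Gate N
  | cnot (control target : Fin N) (h : control ≠ target) : Gate N

/-- The `2 ^ N × 2 ^ N` matrix of a gate. -/
def Gate.matrix {N : ℕ} : Gate N → Op N
  | .hadamard q => fun x y =>
      if ∀ i, i ≠ q → x i = y i then
        (if x q = true ∧ y q = true then -1 else 1) / (Real.sqrt 2 : ℂ)
      else 0
  | .phaseT q => Matrix.diagonal fun x =>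
      if x q = true then Complex.exp (Complex.I * Real.pi / 4) else 1
  | .cnot c t _ => fun x y =>
      if x = Function.update y t (xor (y t) (y c)) then 1 else 0

/-- The matrix of a sequence of gates; the head of the list is applied first. -/
def gatesMatrix {N : ℕ} : List (Gate N) → Op N
  | [] => 1
  | g :: gs => gatesMatrix gs * g.matrix

/-- A circuit: a number of wires, a sequence of gates, and a designated output wire. -/
structure Circuit where
  wires : ℕ
  output : Fin wires
  gates : List (Gate wires)

/-- Self-delimiting unary notation. -/
def unary (k : ℕ) : List Bool := List.replicate k true ++ [false]

def Gate.encode {N : ℕ} : Gate N → List Bool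
  | .hadamard q => [false, false] ++ unary q
  | .phaseT q => [false, true] ++ unary q
  | .cnot c t _ => [true, false] ++ unary c ++ unary t

/-- The description of a circuit as a bit string. -/
def Circuit.encode (C : Circuit) : List Bool :=
  unary C.wires ++ unary C.output ++ (C.gates.map Gate.encode).flatten

theorem unary_append_inj {k l : ℕ} {r s : List Bool} (h : unary k ++ r = unary l ++ s) :
    k = l ∧ r = s := by
  induction k generalizing l with
  | zero => cases l <;> simp_all [unary, List.replicate_succ]
  | succ k ih =>
    cases l with
    | zero => simp_all [unary, List.replicate_succ]
    | succ l =>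
      have := @ih l (by simpa [unary, List.replicate_succ] using h)
      simpa using this

theorem Gate.encode_append_inj {N : ℕ} {g g' : Gate N} {r s : List Bool}
    (h : g.encode ++ r = g'.encode ++ s) : g = g' ∧ r = s := by
  cases g <;> cases g' <;> simp only [Gate.encode, List.cons_append, List.nil_append,
    List.append_assoc, List.cons.injEq, reduceCtorEq, true_and, false_and, and_false] at h
  · obtain ⟨h1, h2⟩ := unary_append_inj h
    exact ⟨by rw [Fin.ext h1], h2⟩
  · obtain ⟨h1, h2⟩ := unary_append_inj h
    exact ⟨by rw [Fin.ext h1], h2⟩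
  · obtain ⟨h1, h2⟩ := unary_append_inj h
    obtain ⟨h3, h4⟩ := unary_append_inj h2
    obtain rfl := Fin.ext h1
    obtain rfl := Fin.ext h3
    exact ⟨rfl, h4⟩

theorem gates_encode_inj {N : ℕ} {l l' : List (Gate N)}
    (h : (l.map Gate.encode).flatten = (l'.map Gate.encode).flatten) : l = l' := by
  induction l generalizing l' with
  | nil =>
    cases l' with
    | nil => rfl
    | cons g' l' => cases g' <;> simp [Gate.encode] at h
  | cons g l ih =>
    cases l' with
    | nil => cases g <;> simp [Gate.encode] at h
    | cons g' l' =>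
      obtain ⟨h1, h2⟩ := Gate.encode_append_inj (by simpa using h)
      rw [h1, ih h2]

/-- A circuit is determined by its description. -/
theorem Circuit.encode_injective : Function.Injective Circuit.encode := by
  rintro ⟨N, o, gs⟩ ⟨N', o', gs'⟩ h
  simp only [Circuit.encode, List.append_assoc] at h
  obtain ⟨h1, h2⟩ := unary_append_inj h
  obtain rfl : N = N' := h1
  obtain ⟨h3, h4⟩ := unary_append_inj h2
  obtain rfl := Fin.ext h3
  rw [gates_encode_inj h4]

/-- The value of wire `i` in the basis label `x`. -/
def wire {N : ℕ} (x : Bits N) (i : ℕ) : Bool := if h : i < N then x ⟨i, h⟩ else false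

/-- The state of `N ≥ a + b` wires with Alice's `a`-qubit register in state `ρ` on wires
`0, …, a - 1`, Bob's `b`-qubit register in state `σ` on wires `a, …, a + b - 1`, and all remaining
wires (the workspace) in state `|0⟩`. -/
def initialState (N : ℕ) {a b : ℕ} (ρ : Op a) (σ : Op b) : Op N := fun x y =>
  if ∀ i : Fin N, a + b ≤ i → x i = false ∧ y i = false then
    ρ (fun i => wire x i) (fun i => wire y i) *
      σ (fun j => wire x (a + j)) (fun j => wire y (a + j))
  else 0

/-- The projection onto the span of the basis states in which the output wire is `1`. -/
def Circuit.outputProj (C : Circuit) : Op C.wires :=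
  Matrix.diagonal fun x => if x C.output = true then 1 else 0

/-- The probability of observing `1` on measuring the output wire, when the circuit is run with
Alice's register in state `ρ` and Bob's register in state `σ`. -/
def Circuit.acceptProb (C : Circuit) {a b : ℕ} (ρ : Op a) (σ : Op b) : ℝ :=
  let U := gatesMatrix C.gates
  (C.outputProj * (U * initialState C.wires ρ σ * Uᴴ)).trace.re

/-- A polynomial-time uniform family of circuits: one deterministic polynomial-time Turing machine
outputs, on every input string `x`, the description of the circuit `V x`. -/
def IsUniform (V : List Bool → Circuit) : Prop :=
  Nonempty (Turing.TM2ComputableInPolyTime (id : List Bool → List Bool) Circuit.encode V)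

/-! ### Promise problems and error parameters -/

/-- A promise problem: two disjoint sets of strings. -/
structure PromiseProblem where
  yes : Set (List Bool)
  no : Set (List Bool)
  disjoint : Disjoint yes no

/-- The pair `(n, k)` in unary, as the string `1ⁿ 0 1ᵏ`. -/
def encodeUnaryPair (p : ℕ × ℕ) : List Bool := unary p.1 ++ List.replicate p.2 true

/-- `c : ℕ → [0,1]` is polynomial-time computable: a polynomial-time Turing machine
computes from `n` and `k` in unary a dyadic rational `f (n, k) / 2 ^ k` within `2 ^ (-k)` of `c n`
(the numerator is output in binary). -/
def IsPolyTimeParam (c : ℕ → ℝ) : Prop :=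
  (∀ n, c n ∈ Set.Icc (0 : ℝ) 1) ∧
  ∃ f : ℕ × ℕ → ℕ,
    Nonempty (Turing.TM2ComputableInPolyTime encodeUnaryPair Computability.encodeNat f) ∧
    ∀ n k, |c n - (f (n, k) : ℝ) / 2 ^ k| ≤ 1 / 2 ^ k

/-- `c - s ∈ Ω(1 / poly(n))`. -/
def HasPolyGap (c s : ℕ → ℝ) : Prop :=
  ∃ q : Polynomial ℕ, ∀ᶠ n in Filter.atTop,
    0 < q.eval n ∧ 1 / ((q.eval n : ℕ) : ℝ) ≤ c n - s n

/-! ### The alternating game with entangled proofs -/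

/-- `IsExtension ρ ρ'`: the density matrix `ρ'` of the enlarged register is consistent with the
state `ρ` of the part that was already revealed. Relative to the empty register this says only
that `ρ'` is a density matrix. -/
def IsExtension {a m : ℕ} (ρ : Op a) (ρ' : Op (a + m)) : Prop :=
  IsDensity ρ' ∧ ptrace ρ' = ρ

mutual
/-- Alice moves next, the sizes of the registers still to be revealed are listed (the two players
alternating), and `ρ`, `σ` are the states revealed so far. The proposition is
`∃ ρ' ∀ σ' ∃ ρ'' …, win`, every state ranging over the extensions of the same player's previous
state. -/
def aliceTurn (win : ∀ a b : ℕ, Op a → Op b → Prop) :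
    List ℕ → ∀ a b : ℕ, Op a → Op b → Prop
  | [], a, b, ρ, σ => win a b ρ σ
  | m :: ms, a, b, ρ, σ => ∃ ρ' : Op (a + m), IsExtension ρ ρ' ∧ bobTurn win ms (a + m) b ρ' σ

/-- The same with Bob moving next: `∀ σ' ∃ ρ' ∀ σ'' …, win`. -/
def bobTurn (win : ∀ a b : ℕ, Op a → Op b → Prop) :
    List ℕ → ∀ a b : ℕ, Op a → Op b → Prop
  | [], a, b, ρ, σ => win a b ρ σ
  | m :: ms, a, b, ρ, σ => ∀ σ' : Op (b + m), IsExtension σ σ' → aliceTurn win ms a (b + m) ρ σ'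
end

mutual
/-- The same game with complemented quantifiers, Alice moving next:
`∀ ρ' ∃ σ' ∀ ρ'' …, win`. -/
def aliceTurnDual (win : ∀ a b : ℕ, Op a → Op b → Prop) :
    List ℕ → ∀ a b : ℕ, Op a → Op b → Prop
  | [], a, b, ρ, σ => win a b ρ σ
  | m :: ms, a, b, ρ, σ =>
      ∀ ρ' : Op (a + m), IsExtension ρ ρ' → bobTurnDual win ms (a + m) b ρ' σ

/-- Complemented quantifiers, Bob moving next: `∃ σ' ∀ ρ' ∃ σ'' …, win`. -/
def bobTurnDual (win : ∀ a b : ℕ, Op a → Op b → Prop) :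
    List ℕ → ∀ a b : ℕ, Op a → Op b → Prop
  | [], a, b, ρ, σ => win a b ρ σ
  | m :: ms, a, b, ρ, σ =>
      ∃ σ' : Op (b + m), IsExtension σ σ' ∧ aliceTurnDual win ms a (b + m) ρ σ'
end

/-- `∃ ρ₁ ∀ ρ₂ ∃ ρ₃ … Qᵢ ρᵢ, win`, where the `j`-th entry of the list is the number of qubits of
the register revealed in turn `j`. No qubits have been revealed at the start, so the initial
states are the scalar `1`. -/
def existsForall (sizes : List ℕ) (win : ∀ a b : ℕ, Op a → Op b → Prop) : Prop :=
  aliceTurn win sizes 0 0 1 1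

/-- `∀ ρ₁ ∃ ρ₂ ∀ ρ₃ … Q̄ᵢ ρᵢ, win`. -/
def forallExists (sizes : List ℕ) (win : ∀ a b : ℕ, Op a → Op b → Prop) : Prop :=
  aliceTurnDual win sizes 0 0 1 1

/-- The total size of the registers at the even positions of a list (those of the player who moves
first), and at the odd positions. -/
def firstPlayerSize : List ℕ → ℕ
  | [] => 0
  | [m] => m
  | m :: _ :: ms => m + firstPlayerSize ms

def secondPlayerSize (sizes : List ℕ) : ℕ := firstPlayerSize sizes.tail

/-! ### The complexity classes -/

/-- The `i`-th level of the entangled quantum polynomial hierarchy with completeness `c` and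
soundness `s`. The register of turn `j` has `p j (n)` qubits for a fixed polynomial `p j`. -/
def QSigmaEParam (i : ℕ) (c s : ℕ → ℝ) : Set PromiseProblem :=
  {L | ∃ (p : Fin i → Polynomial ℕ) (V : List Bool → Circuit),
    IsUniform V ∧
    ∀ x : List Bool,
      let sizes := List.ofFn fun j => (p j).eval x.length
      firstPlayerSize sizes + secondPlayerSize sizes ≤ (V x).wires ∧
      (x ∈ L.yes → existsForall sizes fun _ _ ρ σ => c x.length ≤ (V x).acceptProb ρ σ) ∧
      (x ∈ L.no → forallExists sizes fun _ _ ρ σ => (V x).acceptProb ρ σ ≤ s x.length)}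

/-- The `i`-th level of the entangled quantum polynomial hierarchy. -/
def QSigmaE (i : ℕ) : Set PromiseProblem :=
  {L | ∃ c s : ℕ → ℝ, IsPolyTimeParam c ∧ IsPolyTimeParam s ∧ HasPolyGap c s ∧
    L ∈ QSigmaEParam i c s}

/-- The entangled quantum polynomial hierarchy. -/
def QEPH : Set PromiseProblem := ⋃ i : ℕ, QSigmaE i

/-- One-turn quantum refereed games with completeness `c` and soundness `s`: Alice and Bob
privately and simultaneously each send one state to the referee. On yes-instances some state
of Alice wins with probability at least `c` against every state of Bob; on no-instances some
state of Bob keeps Alice's winning probability at most `s` against every state of Alice. -/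
def QRG1Param (c s : ℕ → ℝ) : Set PromiseProblem :=
  {L | ∃ (p q : Polynomial ℕ) (V : List Bool → Circuit),
    IsUniform V ∧
    ∀ x : List Bool,
      p.eval x.length + q.eval x.length ≤ (V x).wires ∧
      (x ∈ L.yes → ∃ ρ : Op (p.eval x.length), IsDensity ρ ∧
        ∀ σ : Op (q.eval x.length), IsDensity σ → c x.length ≤ (V x).acceptProb ρ σ) ∧
      (x ∈ L.no → ∃ σ : Op (q.eval x.length), IsDensity σ ∧
        ∀ ρ : Op (p.eval x.length), IsDensity ρ → (V x).acceptProb ρ σ ≤ s x.length)}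

/-- One-turn quantum refereed games. -/
def QRG1 : Set PromiseProblem :=
  {L | ∃ c s : ℕ → ℝ, IsPolyTimeParam c ∧ IsPolyTimeParam s ∧ HasPolyGap c s ∧
    L ∈ QRG1Param c s}

end QGames

end

namespace QGames

open Matrix

/-! ### Density matrices and partial traces -/

-- For a fixed circuit the acceptance probability is bilinear in Alice's and Bob's states. The
-- states extending a given density matrix form a nonempty compact convex set, so by Sion's minimax
-- theorem the statements "some state of Alice reaches the threshold against every state of Bob" and
-- "every state of Bob is answered by some state of Alice reaching it" are equivalent, even when
-- both players are bound by what they have already revealed. Because a player's successive states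
-- must be consistent, they are all marginals of the last one: two choices by the same player, once
-- adjacent, merge into one choice of a larger extension. Alternately swapping and merging collapses
-- any number of turns to one state per player (`turn_iff`). Negating the payoff and exchanging the
-- players treats no-instances (`turnDual_iff`, `forallExists_iff`). Circuits and thresholds never
-- change, so each level lies in `QRG1`, and `QRG1` lies in level two.

theorem IsDensity.diag_le_one {n : ℕ} {ρ : Op n} (h : IsDensity ρ) (i : Bits n) : ρ i i ≤ 1 := by
  rw [← h.2]
  exact Finset.single_le_sum (f := fun i => ρ i i) (fun j _ => h.1.diag_nonneg)
    (Finset.mem_univ i)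

/-- Nonnegativity of the principal minor on `i, j` bounds the squared modulus of the entry by a
product of diagonal entries. This is the boundedness half of compactness. -/
theorem IsDensity.norm_apply_le_one {n : ℕ} {ρ : Op n} (h : IsDensity ρ) (i j : Bits n) :
    ‖ρ i j‖ ≤ 1 := by
  have hdet := (h.1.submatrix ![i, j]).det_nonneg
  rw [det_fin_two] at hdet
  simp only [submatrix_apply, cons_val_zero, cons_val_one] at hdet
  rw [← h.1.isHermitian.apply j i, ← starRingEnd_apply, Complex.mul_conj, sub_nonneg] at hdet
  have hle : ρ i i * ρ j j ≤ 1 :=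
    mul_le_one₀ (h.diag_le_one i) h.1.diag_nonneg (h.diag_le_one j)
  have hsq : Complex.normSq (ρ i j) ≤ 1 := by exact_mod_cast hdet.trans hle
  rw [Complex.normSq_eq_norm_sq] at hsq
  exact (sq_le_one_iff₀ (norm_nonneg _)).1 hsq

theorem isClosed_setOf_isDensity (n : ℕ) : IsClosed {ρ : Op n | IsDensity ρ} := by
  have hset : {ρ : Op n | IsDensity ρ} =
      {ρ | ρᴴ = ρ} ∩ (⋂ x : Bits n → ℂ, {ρ | 0 ≤ star x ⬝ᵥ (ρ *ᵥ x)}) ∩ {ρ | ρ.trace = 1} := by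
    ext ρ
    simp [IsDensity, posSemidef_iff_dotProduct_mulVec, IsHermitian]
  rw [hset]
  refine ((isClosed_eq (by fun_prop) (by fun_prop)).inter (isClosed_iInter fun x => ?_)).inter
    (isClosed_eq (by fun_prop) (by fun_prop))
  exact isClosed_le continuous_const (by fun_prop)

theorem isCompact_setOf_isDensity (n : ℕ) : IsCompact {ρ : Op n | IsDensity ρ} := by
  have hbox : IsCompact (Set.univ.pi fun _ : Bits n =>
      Set.univ.pi fun _ : Bits n => Metric.closedBall (0 : ℂ) 1) :=
    isCompact_univ_pi fun _ => isCompact_univ_pi fun _ => isCompact_closedBall 0 1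
  refine hbox.of_isClosed_subset (isClosed_setOf_isDensity n) fun ρ hρ i _ j _ => ?_
  simpa using IsDensity.norm_apply_le_one hρ i j

theorem convex_setOf_isDensity (n : ℕ) : Convex ℝ {ρ : Op n | IsDensity ρ} := by
  intro ρ hρ σ hσ s t hs ht hst
  refine ⟨(hρ.1.smul hs).add (hσ.1.smul ht), ?_⟩
  rw [trace_add, trace_smul, trace_smul, hρ.2, hσ.2, ← add_smul, hst, one_smul]

theorem eq_one_of_isDensity {ρ : Op 0} (h : IsDensity ρ) : ρ = 1 := by
  ext i j
  obtain rfl := Subsingleton.elim i j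
  rw [one_apply_eq, ← h.2]
  exact (Fintype.sum_subsingleton (fun i => ρ i i) i).symm

theorem isDensity_one : IsDensity (1 : Op 0) := ⟨.one, by simp⟩

/-- The partial trace over the last `m` qubits, as a linear map. -/
noncomputable def ptraceLinear (a m : ℕ) : Op (a + m) →ₗ[ℝ] Op a where
  toFun := ptrace
  map_add' ρ σ := by
    ext u v
    simp [ptrace, Finset.sum_add_distrib]
  map_smul' r ρ := by
    ext u v
    simp [ptrace, Finset.mul_sum]

theorem trace_ptrace {a m : ℕ} (ρ : Op (a + m)) : (ptrace ρ).trace = ρ.trace := by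
  simp only [Matrix.trace, diag_apply, ptrace]
  rw [← Fintype.sum_prod_type', ← (Fin.appendEquiv a m).sum_comp]
  rfl

theorem IsDensity.ptrace {a m : ℕ} {ρ : Op (a + m)} (h : IsDensity ρ) :
    IsDensity (ptrace ρ) := by
  refine ⟨?_, by rw [trace_ptrace, h.2]⟩
  -- One principal submatrix for each label of the traced-out register; each is positive
  -- semidefinite.
  have hsum : QGames.ptrace ρ =
      ∑ w : Bits m, ρ.submatrix (fun u => Fin.append u w) (fun u => Fin.append u w) := by
    ext u v
    simp [QGames.ptrace, Matrix.sum_apply]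
  rw [hsum]
  exact posSemidef_sum _ fun w _ => h.1.submatrix _

theorem IsDensity.exists_isExtension {a : ℕ} {ρ : Op a} (h : IsDensity ρ) (m : ℕ) :
    ∃ ρ' : Op (a + m), IsExtension ρ ρ' := by
  -- The extension is `ρ ⊗ |0⟩⟨0|`, written as an entrywise product of two pulled-back matrices so
  -- that positivity follows from the Schur product theorem.
  let d : Bits m → ℂ := Pi.single 0 1
  let ρ' : Op (a + m) := (ρ.submatrix (fun x i => x (Fin.castAdd m i))
      (fun x i => x (Fin.castAdd m i))) ⊙
    ((diagonal d).submatrix (fun x i => x (Fin.natAdd a i)) (fun x i => x (Fin.natAdd a i)))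
  have hd : 0 ≤ d := Pi.single_nonneg.2 zero_le_one
  have htr : QGames.ptrace ρ' = ρ := by
    ext u v
    simp only [QGames.ptrace, ρ', hadamard_apply, submatrix_apply, Fin.append_left,
      Fin.append_right, diagonal_apply_eq, ← Finset.mul_sum]
    exact (congrArg _ (Fintype.sum_pi_single' 0 1)).trans (mul_one _)
  refine ⟨ρ', ⟨(h.1.submatrix _).hadamard ((PosSemidef.diagonal hd).submatrix _), ?_⟩, htr⟩
  rw [← trace_ptrace, htr, h.2]

/-! ### Extensions by several registers -/

/-- The partial trace over registers whose sizes are listed. -/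
noncomputable def ptraceList : ∀ (l : List ℕ) (a : ℕ), Op (l.foldl (· + ·) a) →ₗ[ℝ] Op a
  | [], _ => LinearMap.id
  | m :: l, a => ptraceLinear a m ∘ₗ ptraceList l (a + m)

/-- The density matrices that restrict to `ρ` once the listed registers are traced out. -/
def extensions (l : List ℕ) {a : ℕ} (ρ : Op a) : Set (Op (l.foldl (· + ·) a)) :=
  {ρ' | IsDensity ρ' ∧ ptraceList l a ρ' = ρ}

theorem IsDensity.ptraceList : ∀ (l : List ℕ) {a : ℕ} {ρ : Op (l.foldl (· + ·) a)},
    IsDensity ρ → IsDensity (ptraceList l a ρ)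
  | [], _, _, h => h
  | _ :: l, _, _, h => (IsDensity.ptraceList l h).ptrace

theorem mem_extensions_nil {a : ℕ} {ρ : Op a} (h : IsDensity ρ) {ρ' : Op a} :
    ρ' ∈ extensions [] ρ ↔ ρ' = ρ :=
  ⟨fun h' => h'.2, fun h' => ⟨h' ▸ h, h'⟩⟩

/-- The intermediate state is forced: it is the partial trace of the final one. This is what merges
consecutive choices of one player. -/
theorem mem_extensions_cons {m : ℕ} {l : List ℕ} {a : ℕ} {ρ : Op a}
    {ρ' : Op (l.foldl (· + ·) (a + m))} :
    ρ' ∈ extensions (m :: l) ρ ↔ ∃ τ : Op (a + m), IsExtension ρ τ ∧ ρ' ∈ extensions l τ := by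
  constructor
  · rintro ⟨h, rfl⟩
    exact ⟨_, ⟨IsDensity.ptraceList l h, rfl⟩, h, rfl⟩
  · rintro ⟨τ, ⟨-, rfl⟩, h, rfl⟩
    exact ⟨h, rfl⟩

theorem extensions_nonempty (l : List ℕ) {a : ℕ} {ρ : Op a} (h : IsDensity ρ) :
    (extensions l ρ).Nonempty := by
  induction l generalizing a with
  | nil => exact ⟨ρ, h, rfl⟩
  | cons m l ih =>
    obtain ⟨τ, hτ⟩ := h.exists_isExtension m
    obtain ⟨ρ', hρ'⟩ := ih hτ.1
    exact ⟨ρ', mem_extensions_cons.2 ⟨τ, hτ, hρ'⟩⟩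

theorem isCompact_extensions (l : List ℕ) {a : ℕ} (ρ : Op a) : IsCompact (extensions l ρ) :=
  (isCompact_setOf_isDensity _).inter_right
    (isClosed_eq (ptraceList l a).continuous_of_finiteDimensional continuous_const)

theorem convex_extensions (l : List ℕ) {a : ℕ} (ρ : Op a) : Convex ℝ (extensions l ρ) :=
  (convex_setOf_isDensity _).inter ((convex_singleton ρ).linear_preimage (ptraceList l a))

/-- Tracing out everything leaves a density matrix on zero qubits, and the trace condition makes it
the scalar `1`. Starting from the empty register is thus no constraint. -/
theorem extensions_one (l : List ℕ) : extensions l (1 : Op 0) = {ρ | IsDensity ρ} :=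
  Set.ext fun _ => ⟨fun h => h.1, fun h => ⟨h, eq_one_of_isDensity (IsDensity.ptraceList l h)⟩⟩

/-! ### Exchanging quantifiers -/

/-- The minimax theorem for a bilinear form, in terms of a threshold. -/
theorem exists_forall_le_iff_forall_exists_le {E F : Type*}
    [AddCommGroup E] [Module ℝ E] [TopologicalSpace E] [IsTopologicalAddGroup E]
    [ContinuousSMul ℝ E] [T2Space E] [FiniteDimensional ℝ E]
    [AddCommGroup F] [Module ℝ F] [TopologicalSpace F] [IsTopologicalAddGroup F]
    [ContinuousSMul ℝ F] [T2Space F] [FiniteDimensional ℝ F]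
    (f : E →ₗ[ℝ] F →ₗ[ℝ] ℝ) {X : Set E} {Y : Set F}
    (hX : X.Nonempty) (cX : Convex ℝ X) (kX : IsCompact X)
    (hY : Y.Nonempty) (cY : Convex ℝ Y) (kY : IsCompact Y) (c : ℝ) :
    (∃ x ∈ X, ∀ y ∈ Y, c ≤ f x y) ↔ ∀ y ∈ Y, ∃ x ∈ X, c ≤ f x y := by
  refine ⟨fun ⟨x, hx, h⟩ y hy => ⟨x, hx, h y hy⟩, fun h => ?_⟩
  -- The minimising variable comes first in Sion's theorem, hence the exchanged arguments. Linear
  -- functionals are continuous and both quasiconvex and quasiconcave.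
  obtain ⟨b, hb, a, ha, hab⟩ := Sion.exists_isSaddlePointOn (f := fun y x => f x y) hY cY kY
    (fun x _ => (f x).continuous_of_finiteDimensional.lowerSemicontinuous.lowerSemicontinuousOn _)
    (fun x _ => ((f x).convexOn cY).quasiconvexOn)
    cX hX kX
    (fun y _ =>
      (f.flip y).continuous_of_finiteDimensional.upperSemicontinuous.upperSemicontinuousOn _)
    (fun y _ => ((f.flip y).concaveOn cX).quasiconcaveOn)
  -- An answer `x` to the saddle strategy `b` suffices: `c ≤ f x b ≤ f a y` for every `y`.
  obtain ⟨x, hx, hc⟩ := h b hb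
  exact ⟨a, ha, fun y hy => hc.trans (hab y hy x hx)⟩

/-- The turns in a list of alternating turns that belong to the player who moves first (`true`)
or second (`false`). -/
def turnsOf : Bool → List ℕ → List ℕ
  | _, [] => []
  | true, m :: ms => m :: turnsOf false ms
  | false, _ :: ms => turnsOf true ms

/-- Registers are appended one at a time, so the game produces left-nested sums; this matches them
with the total sizes used in the classes. -/
theorem foldl_turnsOf_true : ∀ (ms : List ℕ) (a : ℕ),
    (turnsOf true ms).foldl (· + ·) a = a + firstPlayerSize ms
  | [], _ => rfl
  | [_], _ => rfl
  | m :: _ :: ms, a => (foldl_turnsOf_true ms (a + m)).trans (add_assoc _ _ _)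

theorem foldl_turnsOf_false (ms : List ℕ) (b : ℕ) :
    (turnsOf false ms).foldl (· + ·) b = b + secondPlayerSize ms := by
  cases ms with
  | nil => rfl
  | cons m ms => exact foldl_turnsOf_true ms b

/-- In the alternating game of a bilinear payoff each player may as well reveal all registers at
once, and the order of the two players is immaterial. -/
theorem turn_iff (F : ∀ a b : ℕ, Op a →ₗ[ℝ] Op b →ₗ[ℝ] ℝ) (c : ℝ) (ms : List ℕ) :
    ∀ {a b : ℕ} {ρ : Op a} {σ : Op b}, IsDensity ρ → IsDensity σ →
    (aliceTurn (fun a b ρ σ => c ≤ F a b ρ σ) ms a b ρ σ ↔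
      ∃ ρ' ∈ extensions (turnsOf true ms) ρ, ∀ σ' ∈ extensions (turnsOf false ms) σ,
        c ≤ F _ _ ρ' σ') ∧
    (bobTurn (fun a b ρ σ => c ≤ F a b ρ σ) ms a b ρ σ ↔
      ∀ σ' ∈ extensions (turnsOf true ms) σ, ∃ ρ' ∈ extensions (turnsOf false ms) ρ,
        c ≤ F _ _ ρ' σ') := by
  have swap (l l' : List ℕ) {a b : ℕ} {ρ : Op a} {σ : Op b} (hρ : IsDensity ρ)
      (hσ : IsDensity σ) :=
    exists_forall_le_iff_forall_exists_le (F _ _) (extensions_nonempty l hρ)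
      (convex_extensions l ρ) (isCompact_extensions l ρ) (extensions_nonempty l' hσ)
      (convex_extensions l' σ) (isCompact_extensions l' σ) c
  induction ms with
  | nil =>
    intro a b ρ σ hρ hσ
    constructor
    · rw [aliceTurn]
      constructor
      · intro h
        exact ⟨ρ, ⟨hρ, rfl⟩, fun σ' hσ' => by obtain rfl := (mem_extensions_nil hσ).1 hσ'; exact h⟩
      · rintro ⟨ρ', hρ', h⟩
        obtain rfl := (mem_extensions_nil hρ).1 hρ'
        exact h σ ⟨hσ, rfl⟩
    · rw [bobTurn]
      constructor
      · intro h σ' hσ'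
        obtain rfl := (mem_extensions_nil hσ).1 hσ'
        exact ⟨ρ, ⟨hρ, rfl⟩, h⟩
      · intro h
        obtain ⟨ρ', hρ', hc⟩ := h σ ⟨hσ, rfl⟩
        obtain rfl := (mem_extensions_nil hρ).1 hρ'
        exact hc
  | cons m ms ih =>
    intro a b ρ σ hρ hσ
    constructor
    · rw [aliceTurn]
      constructor
      · rintro ⟨τ, hτ, h⟩
        -- The induction hypothesis lets Alice's later state depend on Bob's; minimax removes the
        -- dependence, after which that state absorbs `τ`.
        obtain ⟨ρ', hρ', h⟩ := (swap _ _ hτ.1 hσ).2 ((ih hτ.1 hσ).2.1 h)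
        exact ⟨ρ', mem_extensions_cons.2 ⟨τ, hτ, hρ'⟩, h⟩
      · rintro ⟨ρ', hρ', h⟩
        obtain ⟨τ, hτ, hρ'⟩ := mem_extensions_cons.1 hρ'
        -- No minimax here: a reply that works uniformly is in particular a reply to each state.
        exact ⟨τ, hτ, (ih hτ.1 hσ).2.2 fun σ' hσ' => ⟨ρ', hρ', h σ' hσ'⟩⟩
    · rw [bobTurn]
      constructor
      · intro h σ' hσ'
        obtain ⟨τ, hτ, hσ'⟩ := mem_extensions_cons.1 hσ'
        obtain ⟨ρ', hρ', h⟩ := (ih hρ hτ.1).1.1 (h τ hτ)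
        exact ⟨ρ', hρ', h σ' hσ'⟩
      · intro h τ hτ
        -- With Bob's revealed state `τ` fixed, minimax turns Alice's replies to its extensions into
        -- a single state, as her turn requires.
        exact (ih hρ hτ.1).1.2 ((swap _ _ hρ hτ.1).2 fun σ' hσ' =>
          h σ' (mem_extensions_cons.2 ⟨τ, hτ, hσ'⟩))

/-- The game with complemented quantifiers is the game in which the players exchange roles. -/
theorem turnDual_iff (win : ∀ a b : ℕ, Op a → Op b → Prop) (ms : List ℕ) :
    ∀ (a b : ℕ) (ρ : Op a) (σ : Op b),
    (aliceTurnDual win ms a b ρ σ ↔ bobTurn (fun b a σ ρ => win a b ρ σ) ms b a σ ρ) ∧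
    (bobTurnDual win ms a b ρ σ ↔ aliceTurn (fun b a σ ρ => win a b ρ σ) ms b a σ ρ) := by
  induction ms with
  | nil => simp [aliceTurnDual, bobTurnDual, aliceTurn, bobTurn]
  | cons m ms ih => simp [aliceTurnDual, bobTurnDual, aliceTurn, bobTurn, ih]

theorem existsForall_iff (F : ∀ a b : ℕ, Op a →ₗ[ℝ] Op b →ₗ[ℝ] ℝ) (c : ℝ) (sizes : List ℕ)
    {A B : ℕ} (hA : firstPlayerSize sizes = A) (hB : secondPlayerSize sizes = B) :
    existsForall sizes (fun a b ρ σ => c ≤ F a b ρ σ) ↔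
      ∃ ρ : Op A, IsDensity ρ ∧ ∀ σ : Op B, IsDensity σ → c ≤ F A B ρ σ := by
  obtain rfl : (turnsOf true sizes).foldl (· + ·) 0 = A := by
    rw [foldl_turnsOf_true, zero_add, hA]
  obtain rfl : (turnsOf false sizes).foldl (· + ·) 0 = B := by
    rw [foldl_turnsOf_false, zero_add, hB]
  rw [existsForall, (turn_iff F c sizes isDensity_one isDensity_one).1, extensions_one,
    extensions_one]
  rfl

theorem forallExists_iff (F : ∀ a b : ℕ, Op a →ₗ[ℝ] Op b →ₗ[ℝ] ℝ) (s : ℝ) (sizes : List ℕ)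
    {A B : ℕ} (hA : firstPlayerSize sizes = A) (hB : secondPlayerSize sizes = B) :
    forallExists sizes (fun a b ρ σ => F a b ρ σ ≤ s) ↔
      ∃ σ : Op B, IsDensity σ ∧ ∀ ρ : Op A, IsDensity ρ → F A B ρ σ ≤ s := by
  obtain rfl : (turnsOf true sizes).foldl (· + ·) 0 = A := by
    rw [foldl_turnsOf_true, zero_add, hA]
  obtain rfl : (turnsOf false sizes).foldl (· + ·) 0 = B := by
    rw [foldl_turnsOf_false, zero_add, hB]
  -- With payoff `-F` and threshold `-s`, Bob becomes the maximiser, so `turn_iff` applies with the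
  -- roles exchanged.
  let G : ∀ b a : ℕ, Op b →ₗ[ℝ] Op a →ₗ[ℝ] ℝ := fun b a => -(F a b).flip
  have hG : (fun (b a : ℕ) (σ : Op b) (ρ : Op a) => F a b ρ σ ≤ s) =
      fun b a σ ρ => -s ≤ G b a σ ρ := by
    funext b a σ ρ
    simp [G]
  rw [forallExists, (turnDual_iff _ _ _ _ _ _).1, hG,
    (turn_iff G (-s) sizes isDensity_one isDensity_one).2,
    -- The collapsed game lets Bob answer Alice's state; minimax gives him one state that is good
    -- against all of hers, as the soundness condition of `QRG1` demands.
    ← exists_forall_le_iff_forall_exists_le (G _ _) (extensions_nonempty _ isDensity_one)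
      (convex_extensions _ _) (isCompact_extensions _ _) (extensions_nonempty _ isDensity_one)
      (convex_extensions _ _) (isCompact_extensions _ _), extensions_one, extensions_one]
  simp [G]

/-! ### The acceptance probability is bilinear -/

/-- The acceptance probability of a circuit as a bilinear form. -/
noncomputable def Circuit.acceptForm (C : Circuit) (a b : ℕ) : Op a →ₗ[ℝ] Op b →ₗ[ℝ] ℝ :=
  LinearMap.mk₂ ℝ (fun ρ σ => C.acceptProb ρ σ)
    (fun ρ ρ' σ => by
      -- The states enter only through `initialState`; multiplication by fixed matrices, the trace
      -- and the real part are all real-linear.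
      have h : initialState C.wires (ρ + ρ') σ =
          initialState C.wires ρ σ + initialState C.wires ρ' σ := by
        ext x y
        simp only [initialState, Matrix.add_apply]
        split_ifs <;> ring
      simp [acceptProb, h, mul_add, add_mul])
    (fun r ρ σ => by
      have h : initialState C.wires (r • ρ) σ = r • initialState C.wires ρ σ := by
        ext x y
        simp only [initialState, Matrix.smul_apply, smul_ite, smul_zero, smul_mul_assoc]
      simp [acceptProb, h])
    (fun ρ σ σ' => by
      have h : initialState C.wires ρ (σ + σ') =
          initialState C.wires ρ σ + initialState C.wires ρ σ' := by
        ext x y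
        simp only [initialState, Matrix.add_apply]
        split_ifs <;> ring
      simp [acceptProb, h, mul_add, add_mul])
    (fun r ρ σ => by
      have h : initialState C.wires ρ (r • σ) = r • initialState C.wires ρ σ := by
        ext x y
        simp only [initialState, Matrix.smul_apply, smul_ite, smul_zero, mul_smul_comm]
      simp [acceptProb, h])

/-! ### The classes -/

/-- A refereed game has one register per player, of size a single polynomial: the sum of the
polynomials of that player's turns. -/
theorem exists_polynomial_firstPlayerSize : ∀ l : List (Polynomial ℕ),
    ∃ P : Polynomial ℕ, ∀ n, firstPlayerSize (l.map (·.eval n)) = P.eval n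
  | [] => ⟨0, fun _ => by simp [firstPlayerSize]⟩
  | [p] => ⟨p, fun _ => rfl⟩
  | p :: _ :: l => by
    obtain ⟨P, hP⟩ := exists_polynomial_firstPlayerSize l
    exact ⟨p + P, fun n => by simp [firstPlayerSize, hP]⟩

theorem QSigmaEParam_subset_QRG1Param (i : ℕ) (c s : ℕ → ℝ) :
    QSigmaEParam i c s ⊆ QRG1Param c s := by
  rintro L ⟨p, V, hV, h⟩
  obtain ⟨P, hP⟩ := exists_polynomial_firstPlayerSize (List.ofFn p)
  obtain ⟨Q, hQ⟩ := exists_polynomial_firstPlayerSize (List.ofFn p).tail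
  have hsizes (n : ℕ) : List.ofFn (fun j => (p j).eval n) = (List.ofFn p).map (·.eval n) := by
    rw [List.map_ofFn]
    rfl
  have hA (n : ℕ) : firstPlayerSize (List.ofFn fun j => (p j).eval n) = P.eval n := by
    rw [hsizes, hP]
  have hB (n : ℕ) : secondPlayerSize (List.ofFn fun j => (p j).eval n) = Q.eval n := by
    rw [hsizes, secondPlayerSize, ← List.map_tail, hQ]
  refine ⟨P, Q, V, hV, fun x => ?_⟩
  obtain ⟨hw, hyes, hno⟩ := h x
  refine ⟨?_, fun hx => ?_, fun hx => ?_⟩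
  · rw [← hA, ← hB]
    exact hw
  · exact (existsForall_iff (V x).acceptForm _ _ (hA _) (hB _)).1 (hyes hx)
  · exact (forallExists_iff (V x).acceptForm _ _ (hA _) (hB _)).1 (hno hx)

/-- With one turn each, the yes-conditions agree up to the empty initial registers. On no-instances
the hierarchy's condition is the formally weaker one, since Bob may answer Alice. -/
theorem QRG1Param_subset_QSigmaEParam_two (c s : ℕ → ℝ) :
    QRG1Param c s ⊆ QSigmaEParam 2 c s := by
  rintro L ⟨p, q, V, hV, h⟩
  refine ⟨![p, q], V, hV, fun x => ?_⟩
  obtain ⟨hw, hyes, hno⟩ := h x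
  have hA : firstPlayerSize (List.ofFn fun j => (![p, q] j).eval x.length) = p.eval x.length := by
    simp [firstPlayerSize]
  have hB : secondPlayerSize (List.ofFn fun j => (![p, q] j).eval x.length) =
      q.eval x.length := by
    simp [secondPlayerSize, firstPlayerSize]
  refine ⟨?_, fun hx => ?_, fun hx => ?_⟩
  · rw [hA, hB]
    exact hw
  · exact (existsForall_iff (V x).acceptForm _ _ hA hB).2 (hyes hx)
  · exact (forallExists_iff (V x).acceptForm _ _ hA hB).2 (hno hx)

theorem QSigmaE_subset_QRG1 (i : ℕ) : QSigmaE i ⊆ QRG1 := fun _ ⟨c, s, hc, hs, hgap, h⟩ =>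
  ⟨c, s, hc, hs, hgap, QSigmaEParam_subset_QRG1Param i c s h⟩

theorem QRG1_subset_QSigmaE_two : QRG1 ⊆ QSigmaE 2 := fun _ ⟨c, s, hc, hs, hgap, h⟩ =>
  ⟨c, s, hc, hs, hgap, QRG1Param_subset_QSigmaEParam_two c s h⟩

end QGames

theorem mainTheorem2 :
    QGames.QRG1 = QGames.QEPH ∧ QGames.QEPH = QGames.QSigmaE 2 := by
  have hsub : QGames.QEPH ⊆ QGames.QRG1 := Set.iUnion_subset QGames.QSigmaE_subset_QRG1
  have htwo : QGames.QSigmaE 2 ⊆ QGames.QEPH := Set.subset_iUnion QGames.QSigmaE 2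
  have hone := QGames.QRG1_subset_QSigmaE_two
  exact ⟨(hone.trans htwo).antisymm hsub, (hsub.trans hone).antisymm htwo⟩
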